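/- Let $r>1$, $\alpha>1$, and let $u$ be a complex-valued function that is analytic at every point of the cut annulus $\{z\in\mathbb C : r^{-1}\le |z|\le r\}\setminus[r^{-1},r]$. Suppose there are constants $u(1),\,u(e^{2\pi i}),\,C_3,\,C_4\in\mathbb C$ such that $$u(e^{it})=u(1)+C_3\,t^{\alpha-1}+o(|t|^{\alpha-1})\quad\text{as } t\to 0,\ \operatorname{Re}t>0,$$ $$u(e^{it})=u(e^{2\pi i})+C_4\,(2\pi-t)^{\alpha-1}+o(|2\pi-t|^{\alpha-1})\quad\text{as } t\to 2\pi,\ \operatorname{Re}t<2\pi,$$ where $t$ is complex and powers are principal. (Thus $u(1)$ and $u(e^{2\pi i})$ denote the one-sided limits of $u$ at the point $1$ from the upper and from the lower side of the cut; they may differ.) Put $$I(u)=\int_0^{2\pi}u(e^{it})\,dt,\qquad T_n(u)=\frac{2\pi}{n}\left(\tfrac12u(1)+\sum_{k=1}^{n-1}u(e^{2\pi ik/n})+\tfrac12u(e^{2\pi i})\right).$$ Then $t\mapsto u(e^{it})$ is integrable on $[0,2\pi]$ and $$T_n(u)-I(u)=2\,(C_3+C_4)\cos\left(\tfrac{\pi}{2}\alpha\right)\Gamma(\alpha)\,\zeta(\alpha)\,n^{-\alpha}+o(n^{-\alpha}),\qquad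 n\to\infty .$$ -/

import Mathlib

open scoped Real Topology Asymptotics

noncomputable section

/-- The closed annulus `r⁻¹ ≤ |z| ≤ r`, cut along the real interval `[r⁻¹, r]`. -/
def cutAnnulus (r : ℝ) : Set ℂ :=
  {z : ℂ | r⁻¹ ≤ ‖z‖ ∧ ‖z‖ ≤ r} \ ((fun x : ℝ => (x : ℂ)) '' Set.Icc r⁻¹ r)

/-- `I(u) = ∫₀^{2π} u(e^{it}) dt`. -/
def circleIntegralI (u : ℂ → ℂ) : ℂ :=
  ∫ t in (0 : ℝ)..(2 * π), u (Complex.exp (Complex.I * (t : ℂ)))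

/-- The non-periodic trapezoidal rule `(2π/n) ∑''_{k=0}^{n} u(e^{2πik/n})`, first and last terms
halved. The function `u` is two-valued at the point `1` of the cut: `uStart` is the value used at
`k = 0` (that is, `u(1)`) and `uEnd` the one used at `k = n` (that is, `u(e^{2πi})`). -/
def trapezoidalRule (u : ℂ → ℂ) (uStart uEnd : ℂ) (n : ℕ) : ℂ :=
  (2 * (π : ℂ) / (n : ℂ)) *
    (uStart / 2
      + ∑ k ∈ Finset.Ico 1 n, u (Complex.exp (2 * (π : ℂ) * Complex.I * (k : ℂ) / (n : ℂ)))
      + uEnd / 2)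

end

/-!
Put `v t = u (exp (i t))`. Replacing `v` by its even part about `π` changes neither the integral nor
the trapezoidal rule, and after subtracting the common endpoint value the new function vanishes at
both ends like `(C₃ + C₄) / 2 · t ^ (α - 1)`; in particular it is a continuous periodic function.
Aliasing expresses its trapezoidal error as the sum of its Fourier coefficients at the nonzero
multiples of `n`. To find their size, the Fourier integral is pushed up into the strip: the top edge
is exponentially small, and each vertical edge is a Laplace integral whose leading term is given by
Watson's lemma. The two edges contribute the factors `I ^ α` and `(-I) ^ α`, whose sum is
`2 cos (π α / 2)`, and summing the resulting `(j n) ^ (-α)` over `j ≥ 1` produces `ζ(α) n ^ (-α)`.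
-/

section Aliasing

open Filter Finset

variable {T : ℝ} [hT : Fact (0 < T)]

theorem sum_fourier_nsmul_period_div {n : ℕ} (hn : 0 < n) (m : ℤ) :
    ∑ k ∈ range n, fourier m (k • ((T / n : ℝ) : AddCircle T)) =
      if (n : ℤ) ∣ m then (n : ℂ) else 0 := by
  set x : AddCircle T := ((T / n : ℝ) : AddCircle T)
  have horder : addOrderOf x = n := AddCircle.addOrderOf_period_div hn
  have hpow (k : ℕ) : fourier m (k • x) = fourier m x ^ k := by
    rw [fourier_apply, fourier_apply, smul_comm, AddCircle.toCircle_nsmul, Circle.coe_pow]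
  have hroot : fourier m x ^ n = 1 := by
    rw [← hpow, ← horder, addOrderOf_nsmul_eq_zero, fourier_eval_zero]
  have hone : fourier m x = 1 ↔ (n : ℤ) ∣ m := by
    rw [fourier_apply, ← horder, addOrderOf_dvd_iff_zsmul_eq_zero, Circle.coe_eq_one,
      ← AddCircle.toCircle_zero (T := T), (AddCircle.injective_toCircle hT.out.ne').eq_iff]
  simp only [hpow]
  split_ifs with hdvd
  · simp [hone.2 hdvd]
  · rw [geom_sum_eq (mt hone.1 hdvd), hroot, sub_self, zero_div]

theorem hasSum_fourierCoeff_int_mul {f : C(AddCircle T, ℂ)} (hf : Summable (fourierCoeff f))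
    {n : ℕ} (hn : 0 < n) :
    HasSum (fun j : ℤ => fourierCoeff f (j * n))
      ((∑ k ∈ range n, f (k • ((T / n : ℝ) : AddCircle T))) / n) := by
  have hn0 : (n : ℂ) ≠ 0 := Nat.cast_ne_zero.2 hn.ne'
  have hsampled : HasSum (fun m : ℤ => fourierCoeff f m * if (n : ℤ) ∣ m then (n : ℂ) else 0)
      (∑ k ∈ range n, f (k • ((T / n : ℝ) : AddCircle T))) := by
    simpa only [smul_eq_mul, ← mul_sum, sum_fourier_nsmul_period_div hn] using
      hasSum_sum (s := range n) fun k _ =>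
        has_pointwise_sum_fourier_series_of_summable hf (k • ((T / n : ℝ) : AddCircle T))
  have hinj : Function.Injective fun j : ℤ => j * (n : ℤ) :=
    mul_left_injective₀ (Nat.cast_ne_zero.2 hn.ne')
  rw [← hinj.hasSum_iff fun m hm => by
    rw [if_neg fun ⟨j, hj⟩ => hm ⟨j, by rw [hj, mul_comm]⟩, mul_zero]] at hsampled
  refine (hsampled.div_const (n : ℂ)).congr_fun fun j => ?_
  simp [hn0]

theorem hasSum_fourierCoeff_add_neg_nat_mul {f : C(AddCircle T, ℂ)}
    (hf : Summable (fourierCoeff f)) {n : ℕ} (hn : 0 < n) :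
    HasSum (fun j : ℕ => fourierCoeff f ((j + 1) * n : ℕ) + fourierCoeff f (-((j + 1) * n : ℕ)))
      ((∑ k ∈ range n, f (k • ((T / n : ℝ) : AddCircle T))) / n - fourierCoeff f 0) := by
  have h := (hasSum_nat_add_iff' 1).2 (hasSum_fourierCoeff_int_mul hf hn).nat_add_neg
  simpa only [Int.cast_natCast, Nat.cast_mul, Nat.cast_add, Nat.cast_one, Finset.sum_range_one,
    Nat.cast_zero, neg_zero, zero_mul, add_sub_add_right_eq_sub, neg_mul] using h

end Aliasing

section Zeta

open Filter

variable {α : ℝ} {c : ℕ → ℂ} {D : ℂ}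

theorem summable_of_tendsto_rpow_mul (hα : 1 < α)
    (h : Tendsto (fun n : ℕ => ((n : ℝ) ^ α : ℝ) * c n) atTop (𝓝 D)) : Summable c := by
  refine summable_of_isBigO_nat (Real.summable_nat_rpow.2 (by linarith : -α < -1)) ?_
  have hbounded := (Asymptotics.isBigO_refl (fun n : ℕ => (n : ℝ) ^ (-α)) atTop).smul
    (h.isBigO_one ℝ)
  refine hbounded.congr' ?_ (by simp)
  filter_upwards [eventually_gt_atTop 0] with n hn
  rw [Complex.real_smul, ← mul_assoc, ← Complex.ofReal_mul, ← Real.rpow_add (by positivity),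
    neg_add_cancel, Real.rpow_zero, Complex.ofReal_one, one_mul]

theorem tendsto_rpow_mul_tsum_multiples (hα : 1 < α)
    (h : Tendsto (fun n : ℕ => ((n : ℝ) ^ α : ℝ) * c n) atTop (𝓝 D)) :
    Tendsto (fun n : ℕ => ((n : ℝ) ^ α : ℝ) * ∑' j : ℕ, c ((j + 1) * n)) atTop
      (𝓝 (D * riemannZeta α)) := by
  obtain ⟨K, hK⟩ := h.norm.bddAbove_range
  have hrescale (n j : ℕ) : (((n : ℝ) ^ α : ℝ) : ℂ) * c ((j + 1) * n) =
      ((((j + 1) * n : ℕ) : ℝ) ^ α : ℝ) * c ((j + 1) * n) * (((j + 1 : ℝ) ^ (-α) : ℝ) : ℂ) := by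
    rw [mul_right_comm, ← Complex.ofReal_mul]
    congr 2
    push_cast
    rw [Real.mul_rpow (by positivity) (by positivity), Real.rpow_neg (by positivity)]
    field_simp
  have hzeta : riemannZeta α = ∑' j : ℕ, (((j + 1 : ℝ) ^ (-α) : ℝ) : ℂ) := by
    rw [zeta_eq_tsum_one_div_nat_add_one_cpow (by simpa using hα)]
    refine tsum_congr fun j => ?_
    rw [Real.rpow_neg (by positivity), one_div]
    push_cast [Complex.ofReal_cpow (by positivity : (0 : ℝ) ≤ j + 1)]
    rfl
  simp only [← tsum_mul_left, hrescale, hzeta]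
  refine tendsto_tsum_of_dominated_convergence (bound := fun j : ℕ => K * (j + 1 : ℝ) ^ (-α))
    ?_ (fun j => ?_) (.of_forall fun n j => ?_)
  · have := (summable_nat_add_iff 1).2 (Real.summable_nat_rpow.2 (by linarith : -α < -1))
    exact (by exact_mod_cast this : Summable fun j : ℕ => (j + 1 : ℝ) ^ (-α)).mul_left K
  · exact (h.comp (tendsto_id.const_mul_atTop' (Nat.succ_pos j))).mul_const _
  · rw [norm_mul, Complex.norm_real, Real.norm_of_nonneg (by positivity)]
    gcongr
    exact hK ⟨_, rfl⟩

end Zeta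

/-- `f` vanishes at `0` like `C t ^ s` (principal power) within the open right half-plane. -/
def HasLeadingPower (f : ℂ → ℂ) (C : ℂ) (s : ℝ) : Prop :=
  (fun t : ℂ => f t - C * t ^ (s : ℂ)) =o[𝓝[{t : ℂ | 0 < t.re}] 0] fun t : ℂ => ‖t‖ ^ s

section Watson

open Complex Filter MeasureTheory Set

variable {f g : ℂ → ℂ} {C C' : ℂ} {s : ℝ}

theorem HasLeadingPower.add (hf : HasLeadingPower f C s) (hg : HasLeadingPower g C' s) :
    HasLeadingPower (fun t => f t + g t) (C + C') s :=
  (Asymptotics.IsLittleO.add hf hg).congr_left fun t => by ring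

theorem HasLeadingPower.div_const (hf : HasLeadingPower f C s) (a : ℂ) :
    HasLeadingPower (fun t => f t / a) (C / a) s :=
  (Asymptotics.IsLittleO.const_mul_left hf a⁻¹).congr_left fun t => by ring

theorem HasLeadingPower.isBigO (hf : HasLeadingPower f C s) :
    f =O[𝓝[{t : ℂ | 0 < t.re}] 0] fun t : ℂ => ‖t‖ ^ s := by
  have hpow : (fun t : ℂ => C * t ^ (s : ℂ)) =O[𝓝[{t : ℂ | 0 < t.re}] 0] fun t : ℂ => ‖t‖ ^ s :=
    .of_bound ‖C‖ (.of_forall fun t => by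
      rw [norm_mul, norm_cpow_real, Real.norm_of_nonneg (by positivity)])
  simpa using Asymptotics.IsLittleO.isBigO hf |>.add hpow

theorem HasLeadingPower.tendsto_zero (hf : HasLeadingPower f C s) (hs : 0 < s) :
    Tendsto f (𝓝[{t : ℂ | 0 < t.re}] 0) (𝓝 0) := by
  refine hf.isBigO.trans_tendsto ((Continuous.tendsto' ?_ 0 0 ?_).mono_left nhdsWithin_le_nhds)
  · exact continuous_norm.rpow_const fun _ => .inr hs.le
  · simp [hs.ne']

theorem HasLeadingPower.exists_eventually_norm_le (hf : HasLeadingPower f C s) :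
    ∃ K ≥ 0, ∀ᶠ ρ in 𝓝[>] (0 : ℝ), ∀ t : ℂ, 0 < t.re → ‖t‖ < ρ → ‖f t‖ ≤ K * ‖t‖ ^ s := by
  obtain ⟨K, hK0, hK⟩ := hf.isBigO.exists_nonneg
  obtain ⟨ρ₀, hρ₀, hball⟩ := Metric.eventually_nhds_iff.1 (eventually_nhdsWithin_iff.1 hK.bound)
  refine ⟨K, hK0, ?_⟩
  filter_upwards [Ioo_mem_nhdsGT hρ₀] with ρ hρ t ht htρ
  simpa [Real.norm_of_nonneg (Real.rpow_nonneg (norm_nonneg t) s)] using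
    hball (by simpa using htρ.trans hρ.2) ht

theorem ofReal_mul_cpow_ofReal {a : ℝ} (ha : 0 ≤ a) (z : ℂ) (hs : s ≠ 0) :
    (a * z : ℂ) ^ (s : ℂ) = (a ^ s : ℝ) * z ^ (s : ℂ) := by
  have hs' : (s : ℂ) ≠ 0 := ofReal_ne_zero.2 hs
  rcases ha.eq_or_lt with rfl | ha
  · simp [hs, hs']
  rcases eq_or_ne z 0 with rfl | hz
  · simp [hs']
  have ha' : (a : ℂ) ≠ 0 := ofReal_ne_zero.2 ha.ne'
  rw [cpow_def_of_ne_zero (mul_ne_zero ha' hz), log_ofReal_mul ha hz, add_mul, Complex.exp_add,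
    cpow_def_of_ne_zero hz, ofReal_cpow ha.le, cpow_def_of_ne_zero ha', ofReal_log ha.le]

theorem HasLeadingPower.tendsto_rpow_mul {ι : Type*} {l : Filter ι} {ω : ι → ℝ} {z : ι → ℂ}
    {p : ℂ} (hf : HasLeadingPower f C s) (hs : 0 < s) (hω : Tendsto ω l atTop)
    (hz : ∀ᶠ i in l, 0 < (z i).re) (hlim : Tendsto (fun i => ω i * z i) l (𝓝 p))
    (hp : 0 ≤ p.re) :
    Tendsto (fun i => (ω i ^ s : ℝ) * f (z i)) l (𝓝 (C * p ^ (s : ℂ))) := by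
  have hωpos : ∀ᶠ i in l, 0 < ω i := hω.eventually_gt_atTop 0
  have hz0 : Tendsto z l (𝓝[{t : ℂ | 0 < t.re}] 0) := by
    refine tendsto_nhdsWithin_iff.2 ⟨?_, hz⟩
    have hinv : Tendsto (fun i => ((ω i)⁻¹ : ℂ)) l (𝓝 0) := by
      exact_mod_cast (continuous_ofReal.tendsto 0).comp (tendsto_inv_atTop_zero.comp hω)
    refine (zero_mul p ▸ hinv.mul hlim).congr' ?_
    filter_upwards [hωpos] with i hi
    exact inv_mul_cancel_left₀ (ofReal_ne_zero.2 hi.ne') _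
  have hmain : Tendsto (fun i => C * (ω i * z i) ^ (s : ℂ)) l (𝓝 (C * p ^ (s : ℂ))) :=
    ((continuousAt_cpow_const_of_re_pos (.inl hp) (by simpa using hs)).tendsto.comp
      hlim).const_mul C
  have herror : Tendsto (fun i => (ω i ^ s : ℝ) * (f (z i) - C * z i ^ (s : ℂ))) l (𝓝 0) := by
    have hbounded := (hlim.norm.rpow_const (.inr hs.le : ‖p‖ ≠ 0 ∨ 0 ≤ s)).isBigO_one ℝ
    have hsmall := (Asymptotics.isBigO_refl (fun i => ω i ^ s) l).smul_isLittleO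
      (Asymptotics.IsLittleO.comp_tendsto hf hz0)
    refine (Asymptotics.isLittleO_one_iff ℝ).1
      ((hsmall.congr' (.of_forall fun i => real_smul) ?_).trans_isBigO hbounded)
    filter_upwards [hωpos] with i hi
    rw [norm_mul, norm_real, Real.norm_of_nonneg hi.le, Real.mul_rpow hi.le (norm_nonneg _)]
    rfl
  refine (add_zero (C * p ^ (s : ℂ)) ▸ hmain.add herror).congr' ?_
  filter_upwards [hωpos] with i hi
  rw [ofReal_mul_cpow_ofReal hi.le _ hs.ne']
  ring

theorem integrableOn_one_add_rpow_mul_exp_neg (s : ℝ) :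
    IntegrableOn (fun x : ℝ => (1 + x) ^ s * Real.exp (-x)) (Ioi 0) := by
  have hcont : ContinuousOn (fun x : ℝ => (1 + x) ^ s * Real.exp (-x)) (Ici 0) :=
    (ContinuousOn.rpow_const (by fun_prop) fun x hx => .inl (by
      have : (0 : ℝ) ≤ x := hx
      positivity)).mul (by fun_prop)
  refine integrable_of_isBigO_exp_neg (b := 1 / 2) (by norm_num) hcont ?_
  have hgrowth := ((isLittleO_rpow_exp_pos_mul_atTop s (b := 1 / 2) (by norm_num)).comp_tendsto
    (tendsto_atTop_add_const_left atTop (1 : ℝ) tendsto_id)).isBigO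
  refine ((hgrowth.mul (Asymptotics.isBigO_refl (fun x => Real.exp (-x)) atTop)).trans ?_)
  refine .of_bound (Real.exp (1 / 2)) (.of_forall fun x => ?_)
  simp only [Function.comp_apply, id, ← Real.exp_add, Real.norm_eq_abs, Real.abs_exp]
  exact Real.exp_le_exp.2 (by linarith)

theorem integral_mul_cpow_mul_exp_neg_Ioi (C p : ℂ) (hs : 0 < s) :
    ∫ x in Ioi (0 : ℝ), C * (x * p) ^ (s : ℂ) * (Real.exp (-x) : ℝ) =
      C * p ^ (s : ℂ) * Real.Gamma (s + 1) := by
  rw [Real.Gamma_eq_integral (by linarith), ← integral_complex_ofReal, ← integral_const_mul]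
  refine setIntegral_congr_fun measurableSet_Ioi fun x hx => ?_
  simp only [ofReal_mul_cpow_ofReal (le_of_lt hx) p hs.ne', add_sub_cancel_right]
  push_cast
  ring

theorem rpow_add_one_mul_integral_eq {ω δ : ℝ} (hω : 0 < ω) (hδ : 0 ≤ δ) (s : ℝ) (g : ℝ → ℂ) :
    (ω ^ (s + 1) : ℝ) * ∫ y in (0 : ℝ)..δ, g y =
      ∫ x in Ioi 0, (Ioc 0 (ω * δ)).indicator (fun x => (ω ^ s : ℝ) * g (x / ω)) x := by
  have hscale := intervalIntegral.integral_comp_div g (a := 0) (b := ω * δ) hω.ne'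
  rw [zero_div, mul_div_cancel_left₀ _ hω.ne', intervalIntegral.integral_of_le (by positivity),
    real_smul] at hscale
  rw [integral_indicator measurableSet_Ioc, Measure.restrict_restrict measurableSet_Ioc,
    inter_eq_left.2 Ioc_subset_Ioi_self, integral_const_mul, hscale, Real.rpow_add_one hω.ne']
  push_cast
  ring

variable {ι : Type*} {l : Filter ι} {ω ε : ι → ℝ} {K ρ δ : ℝ} {e : ℂ}

theorem tendsto_rpow_add_one_mul_integral [l.IsCountablyGenerated] (hω : Tendsto ω l atTop)
    (hδ : 0 < δ) {g : ι → ℝ → ℂ} {G : ℝ → ℂ} {B : ℝ → ℝ}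
    (hcont : ∀ᶠ i in l, ContinuousOn (g i) (Ioc 0 δ)) (hB : IntegrableOn B (Ioi 0))
    (hbound : ∀ᶠ i in l, ∀ x > 0, x / ω i ∈ Ioc 0 δ → ω i ^ s * ‖g i (x / ω i)‖ ≤ B x)
    (hlim : ∀ x > 0, Tendsto (fun i => (ω i ^ s : ℝ) * g i (x / ω i)) l (𝓝 (G x))) :
    Tendsto (fun i => (ω i ^ (s + 1) : ℝ) * ∫ y in (0 : ℝ)..δ, g i y) l
      (𝓝 (∫ x in Ioi 0, G x)) := by
  have hωpos : ∀ᶠ i in l, 0 < ω i := hω.eventually_gt_atTop 0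
  have hscaled {ω x : ℝ} (hω : 0 < ω) (hx : x ∈ Ioc 0 (ω * δ)) : x / ω ∈ Ioc 0 δ :=
    ⟨div_pos hx.1 hω, (div_le_iff₀' hω).2 hx.2⟩
  suffices Tendsto (fun i => ∫ x in Ioi 0,
      (Ioc 0 (ω i * δ)).indicator (fun x => (ω i ^ s : ℝ) * g i (x / ω i)) x) l
      (𝓝 (∫ x in Ioi 0, G x)) by
    refine this.congr' ?_
    filter_upwards [hωpos] with i hi using (rpow_add_one_mul_integral_eq hi hδ.le s (g i)).symm
  refine tendsto_integral_filter_of_dominated_convergence (fun x => ‖B x‖) ?_ ?_ hB.norm ?_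
  · filter_upwards [hωpos, hcont] with i hi hgi
    have hscaledCont : ContinuousOn (fun x => (ω i ^ s : ℝ) * g i (x / ω i))
        (Ioc 0 (ω i * δ)) :=
      continuousOn_const.mul (hgi.comp (by fun_prop) fun x hx => hscaled hi hx)
    exact ((aestronglyMeasurable_indicator_iff measurableSet_Ioc).2
      (hscaledCont.aestronglyMeasurable measurableSet_Ioc)).restrict
  · filter_upwards [hωpos, hbound] with i hi hgi
    refine ae_restrict_of_forall_mem measurableSet_Ioi fun x hx => ?_
    by_cases hxδ : x ∈ Ioc 0 (ω i * δ)
    · rw [indicator_of_mem hxδ, norm_mul, norm_real,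
        Real.norm_of_nonneg (Real.rpow_nonneg hi.le s)]
      exact (hgi x hx (hscaled hi hxδ)).trans (le_abs_self _)
    · rw [indicator_of_notMem hxδ, norm_zero]
      positivity
  · refine ae_restrict_of_forall_mem measurableSet_Ioi fun x hx => (hlim x hx).congr' ?_
    filter_upwards [hω.eventually_ge_atTop (x / δ)] with i hi
    have hxδ : x ∈ Ioc 0 (ω i * δ) := ⟨hx, (div_le_iff₀ hδ).1 hi⟩
    rw [indicator_of_mem hxδ]

theorem norm_ofReal_add_ofReal_mul_le {a b : ℝ} (ha : 0 ≤ a) (hb : 0 ≤ b) (he : ‖e‖ ≤ 1) :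
    ‖(a + b * e : ℂ)‖ ≤ a + b := by
  refine (norm_add_le _ _).trans ?_
  rw [norm_mul, norm_real, norm_real, Real.norm_of_nonneg ha, Real.norm_of_nonneg hb]
  gcongr
  exact mul_le_of_le_one_right hb he

theorem rpow_mul_norm_le_one_add_rpow {ω ε x : ℝ} {z : ℂ} (hK : 0 ≤ K) (hs : 0 ≤ s)
    (hω : 0 < ω) (hε : 0 ≤ ε) (hωε : ω * ε ≤ 1) (hx : 0 ≤ x) (he : ‖e‖ ≤ 1)
    (hz : ‖z‖ ≤ K * ‖(ε + (x / ω : ℝ) * e : ℂ)‖ ^ s) :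
    ω ^ s * ‖z‖ ≤ K * (1 + x) ^ s := by
  have hnorm := norm_ofReal_add_ofReal_mul_le hε (div_nonneg hx hω.le) he
  calc ω ^ s * ‖z‖ ≤ ω ^ s * (K * (ε + x / ω) ^ s) := by grw [hz, hnorm]
    _ = K * (ω * (ε + x / ω)) ^ s := by rw [Real.mul_rpow hω.le (by positivity)]; ring
    _ = K * (ω * ε + x) ^ s := by rw [mul_add, mul_div_cancel₀ _ hω.ne']
    _ ≤ K * (1 + x) ^ s := by gcongr

theorem tendsto_mul_add_div_mul (hω : Tendsto ω l atTop)
    (hωε : Tendsto (fun i => ω i * ε i) l (𝓝 0)) (x : ℝ) (e : ℂ) :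
    Tendsto (fun i => ω i * (ε i + (x / ω i : ℝ) * e : ℂ)) l (𝓝 (x * e)) := by
  have hadd : Tendsto (fun i => ((ω i * ε i : ℝ) + x * e : ℂ)) l (𝓝 ((0 : ℝ) + x * e)) :=
    ((continuous_ofReal.tendsto 0).comp hωε).add_const _
  rw [ofReal_zero, zero_add] at hadd
  refine hadd.congr' ?_
  filter_upwards [hω.eventually_gt_atTop 0] with i hi
  have := ofReal_ne_zero.2 hi.ne'
  push_cast
  field_simp

theorem HasLeadingPower.tendsto_rpow_mul_integral_exp_neg [l.IsCountablyGenerated]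
    (hf : HasLeadingPower f C s) (hs : 0 < s) (hK0 : 0 ≤ K)
    (hK : ∀ t : ℂ, 0 < t.re → ‖t‖ < ρ → ‖f t‖ ≤ K * ‖t‖ ^ s)
    (hcont : ContinuousOn f {t | 0 < t.re ∧ ‖t‖ < ρ}) (hδ : 0 < δ) (hδρ : δ < ρ)
    (he : ‖e‖ ≤ 1) (here : 0 ≤ e.re) (hω : Tendsto ω l atTop) (hε : ∀ᶠ i in l, 0 < ε i)
    (hωε : Tendsto (fun i => ω i * ε i) l (𝓝 0)) :
    Tendsto (fun i => (ω i ^ (s + 1) : ℝ) *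
        ∫ y in (0 : ℝ)..δ, f (ε i + y * e) * (Real.exp (-(ω i * y)) : ℝ)) l
      (𝓝 (C * e ^ (s : ℂ) * Real.Gamma (s + 1))) := by
  have hωpos : ∀ᶠ i in l, 0 < ω i := hω.eventually_gt_atTop 0
  have hε0 : Tendsto ε l (𝓝 0) := by
    refine (zero_mul (0 : ℝ) ▸ (tendsto_inv_atTop_zero.comp hω).mul hωε).congr' ?_
    filter_upwards [hωpos] with i hi using inv_mul_cancel_left₀ hi.ne' _
  have hre {ε y : ℝ} (hε : 0 < ε) (hy : 0 ≤ y) : 0 < (ε + y * e : ℂ).re := by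
    simpa using add_pos_of_pos_of_nonneg hε (mul_nonneg hy here)
  have hmem : ∀ᶠ i in l, ∀ y ∈ Ioc 0 δ, 0 < (ε i + y * e : ℂ).re ∧ ‖(ε i + y * e : ℂ)‖ < ρ := by
    filter_upwards [hε, hε0.eventually_lt_const (sub_pos.2 hδρ)] with i hi hiρ y hy
    exact ⟨hre hi hy.1.le,
      (norm_ofReal_add_ofReal_mul_le hi.le hy.1.le he).trans_lt (by linarith [hy.2])⟩
  rw [← integral_mul_cpow_mul_exp_neg_Ioi C e hs]
  refine tendsto_rpow_add_one_mul_integral hω hδ ?_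
    ((integrableOn_one_add_rpow_mul_exp_neg s).const_mul K) ?_ fun x hx => ?_
  · filter_upwards [hmem] with i himem
    exact (hcont.comp (by fun_prop) himem).mul (by fun_prop)
  · filter_upwards [hωpos, hε, hmem, hωε.eventually_le_const one_pos]
      with i hi hεi himem hωεi x hx hxδ
    have ht := himem _ hxδ
    have hz := rpow_mul_norm_le_one_add_rpow hK0 hs.le hi hεi.le hωεi hx.le he (hK _ ht.1 ht.2)
    rw [norm_mul, norm_real, Real.norm_of_nonneg (Real.exp_nonneg _), mul_div_cancel₀ _ hi.ne',
      ← mul_assoc, ← mul_assoc]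
    gcongr
  · have hp := tendsto_mul_add_div_mul hω hωε x e
    have hz : ∀ᶠ i in l, 0 < (ε i + (x / ω i : ℝ) * e : ℂ).re := by
      filter_upwards [hωpos, hε] with i hi hεi using hre hεi (by positivity)
    have hlim := hf.tendsto_rpow_mul hs hω hz hp (by simpa using mul_nonneg hx.le here)
    refine (hlim.mul_const ((Real.exp (-x) : ℝ) : ℂ)).congr' ?_
    filter_upwards [hωpos] with i hi
    rw [mul_div_cancel₀ _ hi.ne', mul_assoc]

end Watson
section Endpoints

open Filter MeasureTheory Set

variable {E : Type*} [NormedAddCommGroup E] {f : ℝ → E} {a b : ℝ} {la lb : E}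

theorem intervalIntegrable_of_continuousOn_Ioo_of_tendsto (hab : a < b)
    (hf : ContinuousOn f (Ioo a b)) (ha : Tendsto f (𝓝[>] a) (𝓝 la))
    (hb : Tendsto f (𝓝[<] b) (𝓝 lb)) : IntervalIntegrable f volume a b := by
  have hext : IntervalIntegrable (extendFrom (Ioo a b) f) volume a b :=
    (continuousOn_Icc_extendFrom_Ioo hf ha hb).intervalIntegrable_of_Icc hab.le
  refine hext.congr_uIoo ?_
  rw [uIoo_of_le hab.le]
  exact extendFrom_extends hf

end Endpoints

/-- The region of the `t`-plane that `t ↦ exp (i t)` wraps around a cut annulus: the two sides of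
the cut are the vertical edges `re t = 0` and `re t = 2π`, which are excluded. -/
def cutStrip (d : ℝ) : Set ℂ := Set.Ioo 0 (2 * π) ×ℂ Set.Ioo (-d) d

section Contour

open Complex Filter MeasureTheory Set

theorem integral_eq_integral_horizontal_add_vertical {F : ℂ → ℂ} {a b h : ℝ}
    (hF : DifferentiableOn ℂ F (uIcc a b ×ℂ uIcc 0 h)) :
    ∫ x in a..b, F x = (∫ x in a..b, F (x + h * I)) + I * (∫ y in (0 : ℝ)..h, F (a + y * I)) -
      I * ∫ y in (0 : ℝ)..h, F (b + y * I) := by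
  have hrect := integral_boundary_rect_eq_zero_of_differentiableOn F (a : ℂ) (b + h * I)
    (by simpa using hF)
  simp only [ofReal_re, ofReal_im, add_re, add_im, mul_re, mul_im, I_re, I_im, mul_zero, mul_one,
    zero_add, add_zero, sub_self, ofReal_zero, zero_mul, smul_eq_mul] at hrect
  linear_combination hrect

theorem rect_subset_cutStrip {a b h d : ℝ} (ha : 0 < a) (hab : a ≤ b) (hb : b < 2 * π)
    (hh : 0 ≤ h) (hhd : h < d) : uIcc a b ×ℂ uIcc 0 h ⊆ cutStrip d := by
  rw [uIcc_of_le hab, uIcc_of_le hh]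
  exact reProdIm_subset_iff'.2 (.inl ⟨Icc_subset_Ioo ha hb, Icc_subset_Ioo (by linarith) hhd⟩)

theorem integral_mul_exp_eq_contour {f : ℂ → ℂ} {d ε δ : ℝ}
    (hf : DifferentiableOn ℂ f (cutStrip d)) (hε : 0 < ε) (hεπ : ε < π) (hδ : 0 ≤ δ) (hδd : δ < d)
    (m : ℕ) :
    ∫ x in ε..(2 * π - ε), f x * exp (I * m * x) =
      (Real.exp (-(δ * m)) : ℝ) * (∫ x in ε..(2 * π - ε), f (x + δ * I) * exp (I * m * x)) +
      I * exp (I * (m * ε)) * (∫ y in (0 : ℝ)..δ, f (ε + y * I) * (Real.exp (-(m * y)) : ℝ)) +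
      -I * exp (-I * (m * ε)) *
        ∫ y in (0 : ℝ)..δ, f (2 * π - (ε + y * -I)) * (Real.exp (-(m * y)) : ℝ) := by
  rw [integral_eq_integral_horizontal_add_vertical (F := fun t => f t * exp (I * m * t))
    ((hf.mono (rect_subset_cutStrip hε (by linarith) (by linarith) hδ hδd)).mul (by fun_prop))]
  have hleft (y : ℝ) : exp (I * m * (ε + y * I)) =
      exp (I * (m * ε)) * (Real.exp (-(m * y)) : ℝ) := by
    rw [ofReal_exp, ← Complex.exp_add]
    congr 1
    push_cast
    linear_combination (m * y : ℂ) * I_mul_I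
  have hright (y : ℝ) : exp (I * m * (2 * π - (ε + y * -I))) =
      exp (-I * (m * ε)) * (Real.exp (-(m * y)) : ℝ) := by
    rw [ofReal_exp, ← Complex.exp_add, ← Complex.exp_periodic.nat_mul m (_ + _)]
    congr 1
    push_cast
    linear_combination (m * y : ℂ) * I_mul_I
  have htop (x : ℝ) : exp (I * m * (x + δ * I)) =
      (Real.exp (-(δ * m)) : ℝ) * exp (I * m * x) := by
    rw [ofReal_exp, ← Complex.exp_add]
    congr 1
    push_cast
    linear_combination (m * δ : ℂ) * I_mul_I
  have hreflect (y : ℝ) : ((2 * π - ε : ℝ) + y * I : ℂ) = 2 * π - (ε + y * -I) := by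
    push_cast
    ring
  simp only [hleft, hright, htop, hreflect, mul_left_comm (f _),
    intervalIntegral.integral_const_mul]
  ring

variable {f : ℂ → ℂ} {C C' : ℂ} {s d : ℝ}

theorem tendsto_ofReal_nhdsGT_zero :
    Tendsto ((↑) : ℝ → ℂ) (𝓝[>] 0) (𝓝[{t : ℂ | 0 < t.re}] 0) :=
  tendsto_nhdsWithin_iff.2
    ⟨(continuous_ofReal.tendsto' 0 0 ofReal_zero).mono_left nhdsWithin_le_nhds,
      eventually_mem_nhdsWithin⟩

theorem tendsto_two_pi_sub_ofReal_nhdsLT :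
    Tendsto (fun x : ℝ => (2 * π - x : ℂ)) (𝓝[<] (2 * π)) (𝓝[{t : ℂ | 0 < t.re}] 0) := by
  refine tendsto_nhdsWithin_iff.2 ⟨(Continuous.tendsto' (by fun_prop) _ _ (by simp)).mono_left
    nhdsWithin_le_nhds, ?_⟩
  filter_upwards [self_mem_nhdsWithin] with x hx using by simpa using hx

theorem ofReal_mem_cutStrip (hd : 0 < d) {x : ℝ} (hx : x ∈ Ioo 0 (2 * π)) :
    (x : ℂ) ∈ cutStrip d := by
  simpa [cutStrip, mem_reProdIm, hd] using hx

theorem two_pi_sub_mem_cutStrip {t : ℂ} (ht : t ∈ cutStrip d) : 2 * π - t ∈ cutStrip d := by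
  obtain ⟨⟨h0, h1⟩, h2, h3⟩ := ht
  refine ⟨⟨?_, ?_⟩, ?_, ?_⟩ <;> simp <;> linarith

theorem HasLeadingPower.tendsto_ofReal_nhdsGT (hs : 0 < s) (hf : HasLeadingPower f C s) :
    Tendsto (fun x : ℝ => f x) (𝓝[>] 0) (𝓝 0) :=
  (hf.tendsto_zero hs).comp tendsto_ofReal_nhdsGT_zero

theorem HasLeadingPower.tendsto_ofReal_nhdsLT (hs : 0 < s)
    (hf : HasLeadingPower (fun t => f (2 * π - t)) C s) :
    Tendsto (fun x : ℝ => f x) (𝓝[<] (2 * π)) (𝓝 0) :=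
  ((hf.tendsto_zero hs).comp tendsto_two_pi_sub_ofReal_nhdsLT).congr fun x => by simp

theorem intervalIntegrable_of_continuousOn_cutStrip (hd : 0 < d) (hf : ContinuousOn f (cutStrip d))
    {A A' : ℂ} (hs : 0 < s) (h0 : HasLeadingPower (fun t => f t - A) C s)
    (h1 : HasLeadingPower (fun t => f (2 * π - t) - A') C' s) :
    IntervalIntegrable (fun x : ℝ => f x) volume 0 (2 * π) := by
  refine intervalIntegrable_of_continuousOn_Ioo_of_tendsto Real.two_pi_pos
    (hf.comp (by fun_prop) fun x hx => ofReal_mem_cutStrip hd hx)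
    (la := A) (lb := A') ?_ ?_
  · simpa using (h0.tendsto_ofReal_nhdsGT hs).add_const A
  · simpa using (HasLeadingPower.tendsto_ofReal_nhdsLT (f := fun t => f t - A') hs h1).add_const A'

theorem exists_norm_le_of_horizontal {δ B : ℝ} (hδ : 0 < δ) (hδd : δ < d)
    (hf : ContinuousOn f (cutStrip d)) (h0 : ∀ t : ℂ, 0 < t.re → ‖t‖ ≤ 2 * δ → ‖f t‖ ≤ B)
    (h1 : ∀ t : ℂ, 0 < t.re → ‖t‖ ≤ 2 * δ → ‖f (2 * π - t)‖ ≤ B) :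
    ∃ M, ∀ x ∈ Ioo 0 (2 * π), ‖f (x + δ * I)‖ ≤ M := by
  obtain ⟨M, hM⟩ := (isCompact_Icc (a := δ) (b := 2 * π - δ)).exists_bound_of_continuousOn
    (f := fun x : ℝ => f (x + δ * I)) (hf.comp (by fun_prop) fun x hx =>
      ⟨by simpa using Icc_subset_Ioo hδ (by linarith) hx, by simpa using ⟨by linarith, hδd⟩⟩)
  refine ⟨max B M, fun x hx => ?_⟩
  rcases le_or_gt x δ with hxδ | hxδ
  · refine (h0 _ (by simpa using hx.1) ?_).trans (le_max_left _ _)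
    exact (norm_ofReal_add_ofReal_mul_le hx.1.le hδ.le norm_I.le).trans (by linarith)
  rcases le_or_gt x (2 * π - δ) with hxδ' | hxδ'
  · exact (hM x ⟨hxδ.le, hxδ'⟩).trans (le_max_right _ _)
  · have hx' : 0 < 2 * π - x := sub_pos.2 hx.2
    have hreflect : (x + δ * I : ℂ) = 2 * π - ((2 * π - x : ℝ) + δ * -I) := by
      push_cast
      ring
    rw [hreflect]
    refine (h1 _ (by simpa using hx') ?_).trans (le_max_left _ _)
    exact (norm_ofReal_add_ofReal_mul_le hx'.le hδ.le (by simp)).trans (by linarith)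

theorem integral_eq_integral_ends_add_middle {E : Type*} [NormedAddCommGroup E] [NormedSpace ℝ E]
    {g : ℝ → E} {b ε : ℝ} (hg : IntervalIntegrable g volume 0 b) (hε : 0 ≤ ε) (hεb : 2 * ε ≤ b) :
    ∫ x in (0 : ℝ)..b, g x =
      (∫ x in (0 : ℝ)..ε, g x) + (∫ x in ε..(b - ε), g x) + ∫ x in (0 : ℝ)..ε, g (b - x) := by
  have hsub {p q : ℝ} (hp : 0 ≤ p) (hpq : p ≤ q) (hq : q ≤ b) : IntervalIntegrable g volume p q :=
    hg.mono_set (by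
      rw [uIcc_of_le hpq, uIcc_of_le (by linarith)]
      exact Icc_subset_Icc hp hq)
  rw [intervalIntegral.integral_comp_sub_left, sub_zero,
    intervalIntegral.integral_add_adjacent_intervals,
    intervalIntegral.integral_add_adjacent_intervals]
  all_goals exact hsub (by linarith) (by linarith) (by linarith)

variable {ι : Type*} {l : Filter ι} {ω ε : ι → ℝ} {K ρ δ : ℝ} {e : ℂ}

theorem tendsto_rpow_mul_integral_near_zero (hs : 0 ≤ s) (hK0 : 0 ≤ K)
    (hK : ∀ t : ℂ, 0 < t.re → ‖t‖ < ρ → ‖f t‖ ≤ K * ‖t‖ ^ s) (hω : ∀ᶠ i in l, 0 ≤ ω i)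
    (hε : ∀ᶠ i in l, ε i ∈ Ioo 0 ρ) (hωε : Tendsto (fun i => ω i * ε i) l (𝓝 0))
    {φ : ι → ℝ → ℂ} (hφ : ∀ i x, ‖φ i x‖ ≤ 1) :
    Tendsto (fun i => (ω i ^ (s + 1) : ℝ) * ∫ x in (0 : ℝ)..ε i, f x * φ i x) l (𝓝 0) := by
  have hs1 : 0 < s + 1 := by linarith
  have hbound : Tendsto (fun i => K * (ω i * ε i) ^ (s + 1)) l (𝓝 0) := by
    simpa [hs1.ne'] using (hωε.rpow_const (.inr hs1.le)).const_mul K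
  refine squeeze_zero_norm' ?_ hbound
  filter_upwards [hω, hε] with i hωi hεi
  have hconst : ∀ x ∈ uIoc 0 (ε i), ‖f x * φ i x‖ ≤ K * ε i ^ s := fun x hx => by
    rw [uIoc_of_le hεi.1.le] at hx
    have hfx := hK x hx.1 (by
      rw [norm_real, Real.norm_of_nonneg hx.1.le]
      exact hx.2.trans_lt hεi.2)
    rw [norm_real, Real.norm_of_nonneg hx.1.le] at hfx
    rw [norm_mul]
    calc ‖f x‖ * ‖φ i x‖ ≤ ‖f x‖ := mul_le_of_le_one_right (norm_nonneg _) (hφ i x)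
      _ ≤ K * ε i ^ s := hfx.trans (by gcongr; exacts [hx.1.le, hx.2])
  have hint := intervalIntegral.norm_integral_le_of_norm_le_const hconst
  rw [sub_zero, abs_of_pos hεi.1, mul_assoc, ← Real.rpow_add_one hεi.1.ne'] at hint
  rw [norm_mul, norm_real, Real.norm_of_nonneg (by positivity), Real.mul_rpow hωi hεi.1.le]
  calc ω i ^ (s + 1) * ‖∫ x in (0 : ℝ)..ε i, f x * φ i x‖
      ≤ ω i ^ (s + 1) * (K * ε i ^ (s + 1)) := by gcongr
    _ = K * (ω i ^ (s + 1) * ε i ^ (s + 1)) := by ring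

theorem tendsto_rpow_mul_exp_neg_mul_zero {c : ℕ → ℂ} {M : ℝ} (hc : ∀ᶠ m in atTop, ‖c m‖ ≤ M)
    (hδ : 0 < δ) (s : ℝ) :
    Tendsto (fun m : ℕ => ((m : ℝ) ^ s : ℝ) * ((Real.exp (-(δ * m)) : ℝ) * c m)) atTop (𝓝 0) := by
  have hdecay : Tendsto (fun m : ℕ => ((m : ℝ) ^ s * Real.exp (-δ * m) * M)) atTop (𝓝 0) := by
    simpa using ((tendsto_rpow_mul_exp_neg_mul_atTop_nhds_zero s δ hδ).comp
      tendsto_natCast_atTop_atTop).mul_const M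
  refine squeeze_zero_norm' ?_ hdecay
  filter_upwards [hc] with m hm
  rw [norm_mul, norm_mul, norm_real, norm_real, Real.norm_of_nonneg (by positivity),
    Real.norm_of_nonneg (by positivity), ← mul_assoc, neg_mul]
  gcongr

theorem HasLeadingPower.tendsto_rpow_mul_vertical [l.IsCountablyGenerated]
    (hf : HasLeadingPower f C s) (hs : 0 < s) (hK0 : 0 ≤ K)
    (hK : ∀ t : ℂ, 0 < t.re → ‖t‖ < ρ → ‖f t‖ ≤ K * ‖t‖ ^ s)
    (hcont : ContinuousOn f {t | 0 < t.re ∧ ‖t‖ < ρ}) (hδ : 0 < δ) (hδρ : δ < ρ)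
    (he : ‖e‖ = 1) (here : 0 ≤ e.re) (hω : Tendsto ω l atTop) (hε : ∀ᶠ i in l, 0 < ε i)
    (hωε : Tendsto (fun i => ω i * ε i) l (𝓝 0)) :
    Tendsto (fun i => (ω i ^ (s + 1) : ℝ) * (e * exp (e * (ω i * ε i)) *
        ∫ y in (0 : ℝ)..δ, f (ε i + y * e) * (Real.exp (-(ω i * y)) : ℝ))) l
      (𝓝 (C * e ^ (s + 1 : ℂ) * Real.Gamma (s + 1))) := by
  have hphase : Tendsto (fun i => exp (e * (ω i * ε i))) l (𝓝 1) := by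
    have hcont : Continuous fun x : ℝ => exp (e * x) := by fun_prop
    simpa [Function.comp_def] using (hcont.tendsto 0).comp hωε
  have hwatson := hf.tendsto_rpow_mul_integral_exp_neg hs hK0 hK hcont hδ hδρ he.le here hω hε hωε
  have he0 : e ≠ 0 := norm_ne_zero_iff.1 (by simp [he])
  have hlimit : e * 1 * (C * e ^ (s : ℂ) * Real.Gamma (s + 1)) =
      C * e ^ (s + 1 : ℂ) * Real.Gamma (s + 1) := by
    rw [cpow_add _ _ he0, cpow_one]
    ring
  exact (hlimit ▸ (hphase.const_mul e).mul hwatson).congr fun i => by ring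

theorem norm_exp_I_mul_natCast_mul (m : ℕ) (x : ℝ) : ‖exp (I * m * x)‖ = 1 := by
  have hreal : I * m * x = ((m * x : ℝ) : ℂ) * I := by
    push_cast
    ring
  rw [hreal, norm_exp_ofReal_mul_I]

theorem norm_integral_mul_exp_le {g : ℝ → ℂ} {b M ε : ℝ} (hM : ∀ x ∈ Ioo 0 b, ‖g x‖ ≤ M)
    (hε : 0 < ε) (hεb : 2 * ε < b) (m : ℕ) :
    ‖∫ x in ε..(b - ε), g x * exp (I * m * x)‖ ≤ M * b := by
  have hM0 : 0 ≤ M := (norm_nonneg _).trans (hM ε ⟨hε, by linarith⟩)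
  have hint : ‖∫ x in ε..(b - ε), g x * exp (I * m * x)‖ ≤ M * |b - ε - ε| := by
    refine intervalIntegral.norm_integral_le_of_norm_le_const fun x hx => ?_
    rw [uIoc_of_le (by linarith)] at hx
    rw [norm_mul, norm_exp_I_mul_natCast_mul, mul_one]
    exact hM x ⟨hε.trans hx.1, by linarith [hx.2]⟩
  refine hint.trans ?_
  rw [abs_of_nonneg (by linarith)]
  gcongr
  linarith

theorem halfDisc_subset_cutStrip (hρd : ρ ≤ d) (hρ : ρ ≤ 2 * π) :
    {t : ℂ | 0 < t.re ∧ ‖t‖ < ρ} ⊆ cutStrip d := by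
  rintro t ⟨ht, htρ⟩
  have him := abs_lt.1 ((abs_im_le_norm t).trans_lt (htρ.trans_le hρd))
  exact ⟨⟨ht, ((re_le_norm t).trans_lt htρ).trans_le hρ⟩, him.1, him.2⟩

theorem tendsto_rpow_mul_integral_top {ε : ℕ → ℝ} (hδ : 0 < δ) (hδd : δ < d)
    (hf : ContinuousOn f (cutStrip d)) {B : ℝ} (h0 : ∀ t : ℂ, 0 < t.re → ‖t‖ ≤ 2 * δ → ‖f t‖ ≤ B)
    (h1 : ∀ t : ℂ, 0 < t.re → ‖t‖ ≤ 2 * δ → ‖f (2 * π - t)‖ ≤ B)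
    (hε : ∀ᶠ m in atTop, ε m ∈ Ioo 0 π) (p : ℝ) :
    Tendsto (fun m : ℕ => ((m : ℝ) ^ p : ℝ) * ((Real.exp (-(δ * m)) : ℝ) *
      ∫ x in ε m..(2 * π - ε m), f (x + δ * I) * exp (I * m * x))) atTop (𝓝 0) := by
  obtain ⟨M, hM⟩ := exists_norm_le_of_horizontal hδ hδd hf h0 h1
  refine tendsto_rpow_mul_exp_neg_mul_zero (M := M * (2 * π)) ?_ hδ p
  filter_upwards [hε] with m hm
  exact norm_integral_mul_exp_le hM hm.1 (by linarith [hm.2]) m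

theorem exists_tendsto_natCast_mul_zero :
    ∃ ε : ℕ → ℝ, (∀ᶠ m in atTop, 0 < ε m) ∧ Tendsto ε atTop (𝓝 0) ∧
      Tendsto (fun m : ℕ => m * ε m) atTop (𝓝 0) := by
  have hm : Tendsto (fun m : ℕ => (m : ℝ)) atTop atTop := tendsto_natCast_atTop_atTop
  refine ⟨fun m => ((m : ℝ) ^ 2)⁻¹, ?_,
    tendsto_inv_atTop_zero.comp ((tendsto_pow_atTop two_ne_zero).comp hm), ?_⟩
  · filter_upwards [eventually_gt_atTop 0] with m hm using by positivity
  · refine (tendsto_inv_atTop_zero.comp hm).congr fun m => ?_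
    rcases eq_or_ne (m : ℝ) 0 with h | h <;> simp [h, pow_two]

theorem HasLeadingPower.exists_norm_le_of_pair {g : ℂ → ℂ} (hf : HasLeadingPower f C s)
    (hg : HasLeadingPower g C' s) {R : ℝ} (hR : 0 < R) :
    ∃ K ≥ 0, ∃ ρ ∈ Ioo 0 R, ∀ t : ℂ, 0 < t.re → ‖t‖ < ρ →
      ‖f t‖ ≤ K * ‖t‖ ^ s ∧ ‖g t‖ ≤ K * ‖t‖ ^ s := by
  obtain ⟨K, hK0, hK⟩ := hf.exists_eventually_norm_le
  obtain ⟨K', -, hK'⟩ := hg.exists_eventually_norm_le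
  obtain ⟨ρ, ⟨hKρ, hKρ'⟩, hρ⟩ := ((hK.and hK').and (Ioo_mem_nhdsGT hR)).exists
  refine ⟨max K K', hK0.trans (le_max_left _ _), ρ, hρ, fun t ht htρ =>
    ⟨(hKρ t ht htρ).trans ?_, (hKρ' t ht htρ).trans ?_⟩⟩ <;> gcongr
  exacts [le_max_left _ _, le_max_right _ _]

theorem tendsto_rpow_mul_integral_middle {ε : ℕ → ℝ} (hs : 0 < s)
    (hf : DifferentiableOn ℂ f (cutStrip d)) (h0 : HasLeadingPower f C s)
    (h1 : HasLeadingPower (fun t => f (2 * π - t)) C' s) (hK0 : 0 ≤ K) (hρ : 0 < ρ) (hρd : ρ < d)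
    (hρπ : ρ < π) (hK : ∀ t : ℂ, 0 < t.re → ‖t‖ < ρ → ‖f t‖ ≤ K * ‖t‖ ^ s)
    (hK' : ∀ t : ℂ, 0 < t.re → ‖t‖ < ρ → ‖f (2 * π - t)‖ ≤ K * ‖t‖ ^ s)
    (hε : ∀ᶠ m in atTop, ε m ∈ Ioo 0 π) (hmε : Tendsto (fun m : ℕ => m * ε m) atTop (𝓝 0)) :
    Tendsto (fun m : ℕ => ((m : ℝ) ^ (s + 1) : ℝ) *
        ∫ x in ε m..(2 * π - ε m), f x * exp (I * m * x)) atTop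
      (𝓝 (C * I ^ (s + 1 : ℂ) * Real.Gamma (s + 1) +
        C' * (-I) ^ (s + 1 : ℂ) * Real.Gamma (s + 1))) := by
  obtain ⟨δ, hδ, hδρ⟩ : ∃ δ > 0, 2 * δ < ρ := ⟨ρ / 3, by linarith, by linarith⟩
  have hsub := halfDisc_subset_cutStrip hρd.le (by linarith)
  have hcont' : ContinuousOn (fun t => f (2 * π - t)) {t : ℂ | 0 < t.re ∧ ‖t‖ < ρ} :=
    hf.continuousOn.comp (by fun_prop) fun t ht => two_pi_sub_mem_cutStrip (hsub ht)
  have hε0 : ∀ᶠ m in atTop, 0 < ε m := hε.mono fun m hm => hm.1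
  have hleft := h0.tendsto_rpow_mul_vertical hs hK0 hK (hf.continuousOn.mono hsub) hδ
    (by linarith) norm_I (by simp) tendsto_natCast_atTop_atTop hε0 hmε
  have hright := h1.tendsto_rpow_mul_vertical hs hK0 hK' hcont' hδ (by linarith)
    (e := -I) (by simp) (by simp) tendsto_natCast_atTop_atTop hε0 hmε
  have hpow (t : ℂ) (htδ : ‖t‖ ≤ 2 * δ) : K * ‖t‖ ^ s ≤ K * ρ ^ s := by
    gcongr
    exact htδ.trans hδρ.le
  have htop := tendsto_rpow_mul_integral_top hδ (by linarith) hf.continuousOn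
    (fun t ht htδ => (hK t ht (htδ.trans_lt hδρ)).trans (hpow t htδ))
    (fun t ht htδ => (hK' t ht (htδ.trans_lt hδρ)).trans (hpow t htδ)) hε (s + 1)
  simp only [ofReal_natCast] at hleft hright
  refine (by simpa only [zero_add] using htop.add (hleft.add hright) : Tendsto _ _ _).congr' ?_
  filter_upwards [hε] with m hεm
  rw [integral_mul_exp_eq_contour hf hεm.1 (by linarith [hεm.2]) hδ.le (by linarith)]
  ring

theorem tendsto_rpow_mul_fourierIntegral (hs : 0 < s) (hd : 0 < d)
    (hf : DifferentiableOn ℂ f (cutStrip d)) (h0 : HasLeadingPower f C s)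
    (h1 : HasLeadingPower (fun t => f (2 * π - t)) C' s) :
    Tendsto (fun m : ℕ => ((m : ℝ) ^ (s + 1) : ℝ) *
        ∫ x in (0 : ℝ)..(2 * π), f x * exp (I * m * x)) atTop
      (𝓝 (C * I ^ (s + 1 : ℂ) * Real.Gamma (s + 1) +
        C' * (-I) ^ (s + 1 : ℂ) * Real.Gamma (s + 1))) := by
  obtain ⟨K, hK0, ρ, ⟨hρ, hρdπ⟩, hK⟩ := h0.exists_norm_le_of_pair h1 (lt_min hd Real.pi_pos)
  obtain ⟨hρd, hρπ⟩ := lt_min_iff.1 hρdπ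
  have hKf := fun t ht htρ => (hK t ht htρ).1
  have hKf' := fun t ht htρ => (hK t ht htρ).2
  obtain ⟨ε, hε0, hεlim, hmε⟩ := exists_tendsto_natCast_mul_zero
  have hε : ∀ᶠ m in atTop, ε m ∈ Ioo 0 ρ := hε0.and (hεlim.eventually_lt_const hρ)
  have hm : ∀ᶠ m : ℕ in atTop, (0 : ℝ) ≤ m := .of_forall fun m => m.cast_nonneg
  have hstart := tendsto_rpow_mul_integral_near_zero hs.le hK0 hKf hm hε hmε
    fun m x => (norm_exp_I_mul_natCast_mul m x).le
  have hend := tendsto_rpow_mul_integral_near_zero hs.le hK0 hKf' hm hε hmε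
    fun m x => (norm_exp_I_mul_natCast_mul m (2 * π - x)).le
  have hmiddle := tendsto_rpow_mul_integral_middle hs hf h0 h1 hK0 hρ hρd hρπ hKf hKf'
    (hε.mono fun m hm => ⟨hm.1, hm.2.trans hρπ⟩) hmε
  have hint (m : ℕ) : IntervalIntegrable (fun x : ℝ => f x * exp (I * m * x)) volume 0 (2 * π) :=
    (intervalIntegrable_of_continuousOn_cutStrip (A := 0) (A' := 0) hd hf.continuousOn hs
      (by simpa using h0) (by simpa using h1)).mul_continuousOn (by fun_prop)
  refine (by simpa only [zero_add, add_zero] using (hstart.add hmiddle).add hend :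
    Tendsto _ _ _).congr' ?_
  filter_upwards [hε] with m hεm
  rw [integral_eq_integral_ends_add_middle (hint m) hεm.1.le (by linarith [hεm.2])]
  push_cast
  ring

end Contour

section TrapezoidalSum

open Complex Filter MeasureTheory Set

theorem I_cpow_add_neg_I_cpow (a : ℝ) :
    I ^ (a : ℂ) + (-I) ^ (a : ℂ) = 2 * (Real.cos (π / 2 * a) : ℂ) := by
  rw [cpow_def_of_ne_zero I_ne_zero, cpow_def_of_ne_zero (neg_ne_zero.2 I_ne_zero), log_I,
    log_neg_I, ofReal_cos, two_cos]
  push_cast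
  ring_nf

theorem exists_continuousMap_addCircle_eqOn_Ioo {E : Type*} [TopologicalSpace E] [RegularSpace E]
    [T2Space E] {T : ℝ} (hT : 0 < T) {f : ℝ → E} {l : E} (hf : ContinuousOn f (Ioo 0 T))
    (h0 : Tendsto f (𝓝[>] 0) (𝓝 l)) (h1 : Tendsto f (𝓝[<] T) (𝓝 l)) :
    ∃ F : C(AddCircle T, E), F 0 = l ∧ ∀ x ∈ Ioo 0 T, F x = f x := by
  have : Fact (0 < T) := ⟨hT⟩
  have hleft := eq_lim_at_left_extendFrom_Ioo hT h0
  have hright := eq_lim_at_right_extendFrom_Ioo hT h1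
  refine ⟨⟨AddCircle.liftIco T 0 (extendFrom (Ioo 0 T) f), AddCircle.liftIco_zero_continuous
    (hleft.trans hright.symm) (continuousOn_Icc_extendFrom_Ioo hf h0 h1)⟩, ?_, fun x hx => ?_⟩
  · rw [← AddCircle.coe_zero, ContinuousMap.coe_mk,
      AddCircle.liftIco_zero_coe_apply (left_mem_Ico.2 hT), hleft]
  · rw [ContinuousMap.coe_mk, AddCircle.liftIco_zero_coe_apply (Ioo_subset_Ico_self hx)]
    exact extendFrom_extends hf x hx

section FourierCoeff

variable [Fact (0 < 2 * π)] {F : AddCircle (2 * π) → ℂ} {f : ℂ → ℂ} {C C' : ℂ} {s d : ℝ}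

theorem fourierCoeff_neg_natCast (hF : ∀ x ∈ Ioo 0 (2 * π), F x = f x) (m : ℕ) :
    fourierCoeff F (-m) = (∫ x in (0 : ℝ)..(2 * π), f x * exp (I * m * x)) / (2 * π) := by
  have hexp (x : ℝ) : 2 * π * I * m * x / (2 * π : ℝ) = I * m * x := by
    push_cast
    field_simp
  have hcongr : ∫ x in (0 : ℝ)..(2 * π), fourier (m : ℤ) (x : AddCircle (2 * π)) * F x =
      ∫ x in (0 : ℝ)..(2 * π), f x * exp (I * m * x) :=
    intervalIntegral.integral_congr_Ioo_of_le Real.two_pi_pos.le fun x hx => by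
      simp only [hF x hx, fourier_coe_apply, Int.cast_natCast, hexp, mul_comm (f x)]
  simp only [fourierCoeff_eq_intervalIntegral F _ 0, zero_add, neg_neg, smul_eq_mul, hcongr,
    real_smul]
  push_cast
  ring

theorem fourierCoeff_natCast (hF : ∀ x ∈ Ioo 0 (2 * π), F x = f x) (m : ℕ) :
    fourierCoeff F m =
      (∫ x in (0 : ℝ)..(2 * π), f (2 * π - x) * exp (I * m * x)) / (2 * π) := by
  have hreflect : ∀ x ∈ Ioo 0 (2 * π), F (-x) = f (2 * π - x) := fun x hx => by
    rw [← AddCircle.coe_neg, ← AddCircle.coe_add_period, neg_add_eq_sub,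
      hF _ ⟨by linarith [hx.2], by linarith [hx.1]⟩]
    push_cast
    rfl
  have hneg : fourierCoeff F m = fourierCoeff (fun x => F (-x)) (-m) := by
    simp only [fourierCoeff]
    rw [← integral_neg_eq_self]
    simp [fourier_apply]
  rw [hneg, fourierCoeff_neg_natCast (F := fun x => F (-x)) (f := fun t => f (2 * π - t)) hreflect]

theorem tendsto_rpow_mul_fourierCoeff_neg (hs : 0 < s) (hd : 0 < d)
    (hf : DifferentiableOn ℂ f (cutStrip d)) (h0 : HasLeadingPower f C s)
    (h1 : HasLeadingPower (fun t => f (2 * π - t)) C' s)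
    (hF : ∀ x ∈ Ioo 0 (2 * π), F x = f x) :
    Tendsto (fun m : ℕ => ((m : ℝ) ^ (s + 1) : ℝ) * fourierCoeff F (-m)) atTop
      (𝓝 ((C * I ^ (s + 1 : ℂ) * Real.Gamma (s + 1) +
        C' * (-I) ^ (s + 1 : ℂ) * Real.Gamma (s + 1)) / (2 * π))) :=
  ((tendsto_rpow_mul_fourierIntegral hs hd hf h0 h1).div_const _).congr fun m => by
    rw [fourierCoeff_neg_natCast hF, mul_div_assoc]

theorem tendsto_rpow_mul_fourierCoeff (hs : 0 < s) (hd : 0 < d)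
    (hf : DifferentiableOn ℂ f (cutStrip d)) (h0 : HasLeadingPower f C s)
    (h1 : HasLeadingPower (fun t => f (2 * π - t)) C' s)
    (hF : ∀ x ∈ Ioo 0 (2 * π), F x = f x) :
    Tendsto (fun m : ℕ => ((m : ℝ) ^ (s + 1) : ℝ) * fourierCoeff F m) atTop
      (𝓝 ((C' * I ^ (s + 1 : ℂ) * Real.Gamma (s + 1) +
        C * (-I) ^ (s + 1 : ℂ) * Real.Gamma (s + 1)) / (2 * π))) :=
  ((tendsto_rpow_mul_fourierIntegral hs hd (hf.comp (by fun_prop) fun _ => two_pi_sub_mem_cutStrip)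
    h1 (by simpa using h0)).div_const _).congr fun m => by
    rw [fourierCoeff_natCast hF, mul_div_assoc]
    rfl

theorem summable_fourierCoeff_of_hasLeadingPower (hs : 0 < s) (hd : 0 < d)
    (hf : DifferentiableOn ℂ f (cutStrip d)) (h0 : HasLeadingPower f C s)
    (h1 : HasLeadingPower (fun t => f (2 * π - t)) C' s)
    (hF : ∀ x ∈ Ioo 0 (2 * π), F x = f x) : Summable (fourierCoeff F) :=
  .of_nat_of_neg
    (summable_of_tendsto_rpow_mul (by linarith) (tendsto_rpow_mul_fourierCoeff hs hd hf h0 h1 hF))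
    (summable_of_tendsto_rpow_mul (by linarith)
      (tendsto_rpow_mul_fourierCoeff_neg hs hd hf h0 h1 hF))

theorem tendsto_rpow_mul_fourierCoeff_add_neg (hs : 0 < s) (hd : 0 < d)
    (hf : DifferentiableOn ℂ f (cutStrip d)) (h0 : HasLeadingPower f C s)
    (h1 : HasLeadingPower (fun t => f (2 * π - t)) C' s)
    (hF : ∀ x ∈ Ioo 0 (2 * π), F x = f x) :
    Tendsto (fun m : ℕ => ((m : ℝ) ^ (s + 1) : ℝ) * (fourierCoeff F m + fourierCoeff F (-m))) atTop
      (𝓝 ((C + C') * (Real.cos (π / 2 * (s + 1)) : ℂ) * (Real.Gamma (s + 1) : ℂ) / π)) := by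
  have hcos := I_cpow_add_neg_I_cpow (s + 1)
  rw [ofReal_add s 1, ofReal_one] at hcos
  convert (tendsto_rpow_mul_fourierCoeff hs hd hf h0 h1 hF).add
    (tendsto_rpow_mul_fourierCoeff_neg hs hd hf h0 h1 hF) using 2
  · ring
  · linear_combination -((C + C') * Real.Gamma (s + 1) / (2 * π)) * hcos

end FourierCoeff

theorem sum_range_addCircle_eq {E : Type*} [AddCommMonoid E] {T : ℝ} (hT : 0 < T)
    {F : AddCircle T → E} {f : ℝ → E} (h0 : F 0 = 0) (hF : ∀ x ∈ Ioo 0 T, F x = f x) {n : ℕ}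
    (hn : 0 < n) :
    ∑ k ∈ Finset.range n, F (k • ((T / n : ℝ) : AddCircle T)) =
      ∑ k ∈ Finset.Ico 1 n, f (T * k / n) := by
  rw [Finset.range_eq_Ico, Finset.sum_eq_sum_Ico_succ_bot hn, zero_smul, h0, zero_add]
  refine Finset.sum_congr rfl fun k hk => ?_
  obtain ⟨hk1, hkn⟩ := Finset.mem_Ico.1 hk
  have hn' : (0 : ℝ) < n := by exact_mod_cast hn
  rw [← AddCircle.coe_nsmul, nsmul_eq_mul, mul_div_left_comm, ← mul_div_assoc]
  refine hF _ ⟨by have : 0 < k := hk1; positivity, ?_⟩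
  rw [div_lt_iff₀ hn']
  gcongr

theorem tendsto_rpow_mul_trapezoidal_sum_sub_integral {f : ℂ → ℂ} {C C' : ℂ} {s d : ℝ}
    (hs : 0 < s) (hd : 0 < d) (hf : DifferentiableOn ℂ f (cutStrip d)) (h0 : HasLeadingPower f C s)
    (h1 : HasLeadingPower (fun t => f (2 * π - t)) C' s) :
    Tendsto (fun n : ℕ => ((n : ℝ) ^ (s + 1) : ℝ) *
        (2 * π / n * ∑ k ∈ Finset.Ico 1 n, f (2 * π * k / n : ℝ) -
          ∫ x in (0 : ℝ)..(2 * π), f x)) atTop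
      (𝓝 (2 * (C + C') * (Real.cos (π / 2 * (s + 1)) : ℂ) * (Real.Gamma (s + 1) : ℂ) *
        riemannZeta (s + 1 : ℝ))) := by
  have : Fact (0 < 2 * π) := ⟨Real.two_pi_pos⟩
  obtain ⟨F, hF0, hF⟩ := exists_continuousMap_addCircle_eqOn_Ioo Real.two_pi_pos
    (f := fun x : ℝ => f x)
    (hf.continuousOn.comp (by fun_prop) fun x hx => ofReal_mem_cutStrip hd hx)
    (h0.tendsto_ofReal_nhdsGT hs) (h1.tendsto_ofReal_nhdsLT hs)
  have hlimit := (tendsto_rpow_mul_tsum_multiples (by linarith)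
    (tendsto_rpow_mul_fourierCoeff_add_neg hs hd hf h0 h1 hF)).const_mul (2 * π : ℂ)
  have hpi : (π : ℂ) ≠ 0 := ofReal_ne_zero.2 Real.pi_ne_zero
  refine (hlimit.congr' ?_).trans (le_of_eq ?_)
  · filter_upwards [eventually_gt_atTop 0] with n hn
    have hsum := hasSum_fourierCoeff_add_neg_nat_mul
      (summable_fourierCoeff_of_hasLeadingPower hs hd hf h0 h1 hF) hn
    have hF0' : fourierCoeff F 0 = (∫ x in (0 : ℝ)..(2 * π), f x) / (2 * π) := by
      simpa using fourierCoeff_neg_natCast hF 0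
    rw [hsum.tsum_eq, hF0', sum_range_addCircle_eq Real.two_pi_pos hF0 hF hn]
    field_simp
  · congr 1
    field_simp

theorem isLittleO_sub_mul_rpow_neg_of_tendsto {c : ℕ → ℂ} {D : ℂ} {α : ℝ}
    (h : Tendsto (fun n : ℕ => ((n : ℝ) ^ α : ℝ) * c n) atTop (𝓝 D)) :
    (fun n : ℕ => c n - D * ((n : ℝ) ^ (-α) : ℝ)) =o[atTop] fun n : ℕ => (n : ℝ) ^ (-α) := by
  have hone : (fun n : ℕ => ((n : ℝ) ^ α : ℝ) * c n - D) =o[atTop] fun _ => (1 : ℝ) :=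
    (Asymptotics.isLittleO_one_iff ℝ).2 (by simpa using h.sub_const D)
  refine ((Asymptotics.isBigO_refl (fun n : ℕ => (n : ℝ) ^ (-α)) atTop).smul_isLittleO
    hone).congr' ?_ (by simp)
  filter_upwards [eventually_gt_atTop 0] with n hn
  rw [real_smul, mul_sub, ← mul_assoc, ← ofReal_mul, ← Real.rpow_add (by positivity),
    neg_add_cancel, Real.rpow_zero, ofReal_one, one_mul, mul_comm D]

end TrapezoidalSum

section Symmetrization

open Complex Filter MeasureTheory Set

/-- The part of `v` that is even about `π`, minus the constant `A`. Passing to the even part changes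
neither a trapezoidal rule nor an integral over `[0, 2π]`, but makes the limits at `0` and `2π`
equal; with `A` their common value, both ends vanish. -/
noncomputable def symmetrizedDeviation (v : ℂ → ℂ) (A t : ℂ) : ℂ :=
  (v t + v (2 * π - t)) / 2 - A

variable {v : ℂ → ℂ} {A A' C C' : ℂ} {s d : ℝ}

theorem symmetrizedDeviation_two_pi_sub (v : ℂ → ℂ) (A t : ℂ) :
    symmetrizedDeviation v A (2 * π - t) = symmetrizedDeviation v A t := by
  simp only [symmetrizedDeviation, sub_sub_cancel, add_comm]

theorem differentiableOn_symmetrizedDeviation (hv : DifferentiableOn ℂ v (cutStrip d)) (A : ℂ) :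
    DifferentiableOn ℂ (symmetrizedDeviation v A) (cutStrip d) :=
  ((hv.add (hv.comp (by fun_prop) fun _ => two_pi_sub_mem_cutStrip)).div_const 2).sub_const A

theorem HasLeadingPower.symmetrizedDeviation (h0 : HasLeadingPower (fun t => v t - A) C s)
    (h1 : HasLeadingPower (fun t => v (2 * π - t) - A') C' s) :
    HasLeadingPower (symmetrizedDeviation v ((A + A') / 2)) ((C + C') / 2) s := by
  convert (h0.add h1).div_const 2 using 2 with t
  rw [_root_.symmetrizedDeviation]
  ring

theorem sum_symmetrizedDeviation {n : ℕ} (hn : 0 < n) :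
    ∑ k ∈ Finset.Ico 1 n, symmetrizedDeviation v A (2 * π * k / n : ℝ) =
      ∑ k ∈ Finset.Ico 1 n, v (2 * π * k / n : ℝ) - (n - 1) * A := by
  have hn' : (n : ℂ) ≠ 0 := Nat.cast_ne_zero.2 hn.ne'
  have hreflect : ∑ k ∈ Finset.Ico 1 n, v (2 * π - (2 * π * k / n : ℝ)) =
      ∑ k ∈ Finset.Ico 1 n, v (2 * π * k / n : ℝ) := by
    have h := Finset.sum_Ico_reflect (fun k : ℕ => v (2 * π * k / n : ℝ)) 1 n.le_succ
    simp only [Nat.add_sub_cancel, Nat.add_sub_cancel_left] at h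
    rw [← h]
    refine Finset.sum_congr rfl fun k hk => ?_
    rw [Nat.cast_sub (Finset.mem_Ico.1 hk).2.le]
    congr 1
    push_cast
    field_simp
  simp only [symmetrizedDeviation, Finset.sum_sub_distrib, ← Finset.sum_div,
    Finset.sum_add_distrib, hreflect, add_self_div_two, Finset.sum_const, Nat.card_Ico,
    nsmul_eq_mul, Nat.cast_sub (Nat.one_le_of_lt hn), Nat.cast_one]

theorem integral_symmetrizedDeviation
    (hv : IntervalIntegrable (fun x : ℝ => v x) volume 0 (2 * π)) :
    ∫ x in (0 : ℝ)..(2 * π), symmetrizedDeviation v A x =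
      (∫ x in (0 : ℝ)..(2 * π), v x) - 2 * π * A := by
  have hcast (x : ℝ) : (2 * π - x : ℂ) = (2 * π - x : ℝ) := by push_cast; rfl
  have hv' : IntervalIntegrable (fun x : ℝ => v (2 * π - x : ℝ)) volume 0 (2 * π) := by
    simpa using (hv.comp_sub_left (2 * π)).symm
  have hreflect := intervalIntegral.integral_comp_sub_left (fun x : ℝ => v x) (2 * π)
    (a := 0) (b := 2 * π)
  simp only [sub_self, sub_zero] at hreflect
  simp only [symmetrizedDeviation, hcast]
  rw [intervalIntegral.integral_sub ((hv.add hv').div_const 2) intervalIntegrable_const,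
    intervalIntegral.integral_div, intervalIntegral.integral_add hv hv', hreflect]
  simp

theorem trapezoidalRule_sub_circleIntegralI {u : ℂ → ℂ}
    (hu : IntervalIntegrable (fun x : ℝ => u (exp (I * x))) volume 0 (2 * π)) {n : ℕ}
    (hn : 0 < n) :
    trapezoidalRule u A A' n - circleIntegralI u =
      2 * π / n * ∑ k ∈ Finset.Ico 1 n, symmetrizedDeviation (fun t => u (exp (I * t)))
          ((A + A') / 2) (2 * π * k / n : ℝ) -
        ∫ x in (0 : ℝ)..(2 * π),
          symmetrizedDeviation (fun t => u (exp (I * t))) ((A + A') / 2) x := by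
  have hn' : (n : ℂ) ≠ 0 := Nat.cast_ne_zero.2 hn.ne'
  have hnode (k : ℕ) : 2 * π * I * k / n = I * (2 * π * k / n : ℝ) := by
    push_cast
    ring
  rw [sum_symmetrizedDeviation hn, integral_symmetrizedDeviation hu, trapezoidalRule,
    circleIntegralI]
  simp only [hnode]
  field_simp
  ring

end Symmetrization

section CutAnnulus

open Complex Filter Set

theorem mapsTo_exp_I_mul_cutStrip_cutAnnulus {r : ℝ} (hr : 0 < r) :
    MapsTo (fun t => exp (I * t)) (cutStrip (Real.log r)) (cutAnnulus r) := by
  rintro t ⟨⟨h0, h1⟩, h2, h3⟩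
  have hnorm : ‖exp (I * t)‖ = Real.exp (-t.im) := by simp [norm_exp]
  refine ⟨⟨?_, ?_⟩, ?_⟩
  · rw [hnorm, ← Real.exp_log (inv_pos.2 hr), Real.log_inv]
    gcongr
  · rw [hnorm, ← Real.le_log_iff_exp_le hr]
    linarith
  · rintro ⟨x, hx, hxt : (x : ℂ) = exp (I * t)⟩
    have hx0 : 0 < x := (inv_pos.2 hr).trans_le hx.1
    have hexp : exp (I * t - Real.log x) = 1 := by
      rw [Complex.exp_sub, ← hxt, ← ofReal_exp, Real.exp_log hx0]
      exact div_self (ofReal_ne_zero.2 hx0.ne')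
    obtain ⟨k, hk⟩ := Complex.exp_eq_one_iff.1 hexp
    have hre : t.re = k * (2 * π) := by simpa using congrArg im hk
    rw [hre] at h0 h1
    have hk0 : (0 : ℝ) < k := pos_of_mul_pos_left h0 Real.two_pi_pos.le
    have hk1 : (k : ℝ) < 1 := by nlinarith [Real.pi_pos]
    norm_cast at hk0 hk1
    omega

theorem hasLeadingPower_sub_of_isLittleO {v : ℂ → ℂ} {A C : ℂ} {s : ℝ}
    (h : (fun t : ℂ => v t - (A + C * t ^ (s : ℂ))) =o[𝓝[{t : ℂ | 0 < t.re}] 0]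
      fun t : ℂ => ‖t‖ ^ s) : HasLeadingPower (fun t => v t - A) C s :=
  h.congr_left fun t => by ring

theorem hasLeadingPower_two_pi_sub_of_isLittleO {v : ℂ → ℂ} {A C : ℂ} {s : ℝ}
    (h : (fun t : ℂ => v t - (A + C * (2 * π - t) ^ (s : ℂ)))
      =o[𝓝[{t : ℂ | t.re < 2 * π}] (2 * π : ℂ)] fun t : ℂ => ‖2 * π - t‖ ^ s) :
    HasLeadingPower (fun t => v (2 * π - t) - A) C s := by
  have hreflect : Tendsto (fun t : ℂ => 2 * π - t) (𝓝[{t : ℂ | 0 < t.re}] 0)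
      (𝓝[{t : ℂ | t.re < 2 * π}] (2 * π : ℂ)) := by
    refine tendsto_nhdsWithin_iff.2 ⟨(Continuous.tendsto' (by fun_prop) _ _ (by simp)).mono_left
      nhdsWithin_le_nhds, ?_⟩
    filter_upwards [self_mem_nhdsWithin] with t ht using by simpa using ht
  refine hasLeadingPower_sub_of_isLittleO ?_
  simpa only [Function.comp_def, sub_sub_cancel] using h.comp_tendsto hreflect

end CutAnnulus

theorem mainTheorem2 (u : ℂ → ℂ) (r α : ℝ) (uStart uEnd C₃ C₄ : ℂ)
    (hr : 1 < r) (hα : 1 < α)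
    (hu : AnalyticOnNhd ℂ u (cutAnnulus r))
    (hStart : (fun t : ℂ => u (Complex.exp (Complex.I * t))
          - (uStart + C₃ * t ^ ((α - 1 : ℝ) : ℂ)))
        =o[𝓝[{t : ℂ | 0 < t.re}] 0] (fun t : ℂ => ‖t‖ ^ (α - 1)))
    (hEnd : (fun t : ℂ => u (Complex.exp (Complex.I * t))
          - (uEnd + C₄ * (2 * (π : ℂ) - t) ^ ((α - 1 : ℝ) : ℂ)))
        =o[𝓝[{t : ℂ | t.re < 2 * π}] (2 * (π : ℂ))]
          (fun t : ℂ => ‖2 * (π : ℂ) - t‖ ^ (α - 1))) :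
    IntervalIntegrable (fun t : ℝ => u (Complex.exp (Complex.I * (t : ℂ))))
        MeasureTheory.volume 0 (2 * π) ∧
    (fun n : ℕ => trapezoidalRule u uStart uEnd n - circleIntegralI u
          - 2 * (C₃ + C₄) * (Real.cos (π / 2 * α) : ℂ) * (Real.Gamma α : ℂ)
              * riemannZeta (α : ℂ) * (((n : ℝ) ^ (-α) : ℝ) : ℂ))
        =o[Filter.atTop] (fun n : ℕ => (n : ℝ) ^ (-α)) := by
  have hs : 0 < α - 1 := sub_pos.2 hα
  have hd : 0 < Real.log r := Real.log_pos hr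
  have hv : DifferentiableOn ℂ (fun t => u (Complex.exp (Complex.I * t))) (cutStrip (Real.log r)) :=
    hu.differentiableOn.comp (by fun_prop)
      (mapsTo_exp_I_mul_cutStrip_cutAnnulus (zero_lt_one.trans hr))
  have h0 := hasLeadingPower_sub_of_isLittleO hStart
  have h1 := hasLeadingPower_two_pi_sub_of_isLittleO
    (v := fun t => u (Complex.exp (Complex.I * t))) hEnd
  have hint := intervalIntegrable_of_continuousOn_cutStrip hd hv.continuousOn hs h0 h1
  refine ⟨hint, isLittleO_sub_mul_rpow_neg_of_tendsto ?_⟩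
  have hw := h0.symmetrizedDeviation h1
  have hlimit := tendsto_rpow_mul_trapezoidal_sum_sub_integral hs hd
    (differentiableOn_symmetrizedDeviation hv _) hw
    (by simpa only [symmetrizedDeviation_two_pi_sub] using hw)
  simp only [add_halves, sub_add_cancel] at hlimit
  refine hlimit.congr' ?_
  filter_upwards [Filter.eventually_gt_atTop 0] with n hn
  rw [trapezoidalRule_sub_circleIntegralI hint hn]
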